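/- Let $F$ be a field of characteristic zero equipped with a norm, i.e. a map $|\cdot|:F\to\mathbb{R}_{\ge 0}$ with $|\lambda|=0$ iff $\lambda=0$, $|\lambda+\mu|\le|\lambda|+|\mu|$, $|-\lambda|=|\lambda|$, $|\lambda\mu|\le|\lambda|\,|\mu|$, and $|n\lambda|=n|\lambda|$ for all $\lambda,\mu\in F$ and $n\in\mathbb{N}$. Algebras are associative and not necessarily unital. A metric $F$-algebra is an $F$-algebra $B$ with a metric $d$ for which there is a real $\gamma>0$ such that, for all $a,b,c\in B$ and $\lambda\in F$, $$d(a+c,b+c)\le\gamma\, d(a,b),\qquad d(\lambda a,\lambda b)\le\gamma|\lambda|\,d(a,b),$$ $$d(ac,bc)\le\gamma\, d(c,0)\,d(a,b),\qquad d(ca,cb)\le\gamma\, d(c,0)\,d(a,b).$$ Its completion $C(B)$ is the metric completion of $B$, with the operations extended by continuity; $B$ is a complete metric $F$-algebra if $(B,d)$ is complete. An algebra is nil if each of its elements has a positive power equal to $0$, and nilpotent if for some $m\ge1$ all products of $m$ of its elements are $0$. Theorem. Let $S$ be a left cancellative monoid with neutral element $e$, and let $A$ be an $F$-algebra with a finite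 $S$-grading: $A=\bigoplus_{s\in S}A_s$ with $F$-subspaces $A_s$ such that $A_sA_t\subseteq A_{st}$ for all $s,t\in S$ and $A_s\neq 0$ for only finitely many $s$. Suppose that the subalgebra $A_e$ is a metric $F$-algebra with respect to some metric. If its completion $C(A_e)$ is nil, then $A$ is nilpotent. In particular, if $A_e$ is a nil complete metric $F$-algebra, then $A$ is nilpotent. -/

import Mathlib

/-- `seqProd a n` is the product `a 0 * a 1 * ⋯ * a n` of `n + 1` factors. -/
def seqProd {A : Type*} [Mul A] (a : ℕ → A) : ℕ → A
  | 0 => a 0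
  | n + 1 => seqProd a n * a (n + 1)

/-- A (not necessarily unital) ring is nil if each of its elements has a positive power
equal to zero. -/
def IsNilRing (A : Type*) [NonUnitalRing A] : Prop :=
  ∀ a : A, ∃ n : ℕ, seqProd (fun _ => a) n = 0

/-- A (not necessarily unital) ring is nilpotent if for some `m ≥ 1` all products of `m`
elements vanish. -/
def IsNilpotentRing (A : Type*) [NonUnitalRing A] : Prop :=
  ∃ n : ℕ, ∀ a : ℕ → A, seqProd a n = 0

/-- Compatibility of a metric on an associative, not necessarily unital, `F`-algebra with its
operations, with respect to a submultiplicative norm `ν` on the field `F`. -/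
structure IsMetricAlgebra {F : Type*} [Field F] (ν : RingNorm F) (B : Type*) [NonUnitalRing B]
    [Module F B] [IsScalarTower F B B] [SMulCommClass F B B] [MetricSpace B] : Prop where
  exists_bound : ∃ γ : ℝ, 0 < γ ∧
    (∀ a b c : B, dist (a + c) (b + c) ≤ γ * dist a b) ∧
    (∀ (r : F) (a b : B), dist (r • a) (r • b) ≤ γ * ν r * dist a b) ∧
    (∀ a b c : B, dist (a * c) (b * c) ≤ γ * dist c 0 * dist a b) ∧
    (∀ a b c : B, dist (c * a) (c * b) ≤ γ * dist c 0 * dist a b)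

namespace IsMetricAlgebra

variable {F : Type*} [Field F] {ν : RingNorm F} {B : Type*} [NonUnitalRing B]
  [Module F B] [IsScalarTower F B B] [SMulCommClass F B B] [MetricSpace B]

theorem isUniformAddGroup (h : IsMetricAlgebra ν B) : IsUniformAddGroup B := by
  obtain ⟨γ, hγ, h1, -, -, -⟩ := h.exists_bound
  have hadd : ∀ a b c d : B, dist (a + b) (c + d) ≤ γ * dist a c + γ * dist b d := by
    intro a b c d
    refine (dist_triangle _ (c + b) _).trans (add_le_add (h1 _ _ _) ?_)
    rw [add_comm c b, add_comm c d]
    exact h1 _ _ _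
  have hneg : ∀ a b : B, dist (-a) (-b) ≤ γ * dist a b := by
    intro a b
    have := h1 b a (-a - b)
    rwa [show b + (-a - b) = -a by abel, show a + (-a - b) = -b by abel, dist_comm b a] at this
  refine IsUniformAddGroup.mk' ?_ ?_
  · refine LipschitzWith.uniformContinuous (K := ⟨γ + γ, by positivity⟩)
      (LipschitzWith.of_dist_le_mul ?_)
    rintro ⟨a, b⟩ ⟨c, d⟩
    have ha : dist a c ≤ dist (a, b) (c, d) := le_max_left _ _
    have hb : dist b d ≤ dist (a, b) (c, d) := le_max_right _ _
    have := hadd a b c d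
    show dist (a + b) (c + d) ≤ (γ + γ) * dist (a, b) (c, d)
    nlinarith
  · exact LipschitzWith.uniformContinuous (K := ⟨γ, hγ.le⟩)
      (LipschitzWith.of_dist_le_mul hneg)

theorem uniformContinuousConstSMul (h : IsMetricAlgebra ν B) :
    UniformContinuousConstSMul F B := by
  obtain ⟨γ, hγ, -, h2, -, -⟩ := h.exists_bound
  exact ⟨fun r => LipschitzWith.uniformContinuous (K := ⟨γ * ν r, by positivity⟩)
    (LipschitzWith.of_dist_le_mul fun a b => h2 r a b)⟩

theorem continuousMul (h : IsMetricAlgebra ν B) : ContinuousMul B := by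
  obtain ⟨γ, hγ, -, -, h3, h4⟩ := h.exists_bound
  refine ⟨continuous_iff_continuousAt.2 ?_⟩
  rintro ⟨a, b⟩
  refine tendsto_iff_dist_tendsto_zero.2 ?_
  have hlim : Filter.Tendsto (fun p : B × B => γ * dist p.2 0 * dist p.1 a +
      γ * dist a 0 * dist p.2 b) (nhds (a, b)) (nhds 0) := by
    have hc : Continuous (fun p : B × B => γ * dist p.2 0 * dist p.1 a +
      γ * dist a 0 * dist p.2 b) := by fun_prop
    simpa using hc.tendsto (a, b)
  refine squeeze_zero (fun _ => dist_nonneg) (fun p => ?_) hlim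
  exact (dist_triangle _ (a * p.2) _).trans (add_le_add (h3 _ _ _) (h4 _ _ _))

/-- The metric completion of a metric algebra. -/
@[nolint unusedArguments]
def Completion (_h : IsMetricAlgebra ν B) : Type _ := UniformSpace.Completion B

namespace Completion

variable (h : IsMetricAlgebra ν B)

/-- The metric of the completion is the extension of the metric of the algebra. -/
noncomputable instance : MetricSpace h.Completion :=
  inferInstanceAs (MetricSpace (UniformSpace.Completion B))

instance : CompleteSpace h.Completion :=
  inferInstanceAs (CompleteSpace (UniformSpace.Completion B))

/-- Addition, zero and negation are extended by continuity. -/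
noncomputable instance : AddCommGroup h.Completion :=
  haveI := h.isUniformAddGroup
  inferInstanceAs (AddCommGroup (UniformSpace.Completion B))

/-- Multiplication by scalars is extended by continuity. -/
noncomputable instance : Module F h.Completion :=
  haveI := h.isUniformAddGroup
  haveI := h.uniformContinuousConstSMul
  inferInstanceAs (Module F (UniformSpace.Completion B))

/-- Multiplication is extended by continuity. -/
noncomputable instance : Mul h.Completion where
  mul := Function.curry
    ((UniformSpace.Completion.isDenseInducing_coe.prodMap
      UniformSpace.Completion.isDenseInducing_coe).extend
        (fun p : B × B => ((p.1 * p.2 : B) : UniformSpace.Completion B)))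

/-- The canonical embedding of a metric algebra in its completion. -/
def of (b : B) : h.Completion := (b : UniformSpace.Completion B)

theorem dist_of (a b : B) : dist (of h a) (of h b) = dist a b :=
  UniformSpace.Completion.dist_eq a b

theorem denseRange_of : DenseRange (of h) :=
  UniformSpace.Completion.denseRange_coe

theorem of_zero : of h 0 = 0 := rfl

theorem of_add (a b : B) : of h (a + b) = of h a + of h b :=
  haveI := h.isUniformAddGroup
  UniformSpace.Completion.coe_add a b

theorem of_smul (r : F) (a : B) : of h (r • a) = r • of h a :=
  haveI := h.uniformContinuousConstSMul
  UniformSpace.Completion.coe_smul r a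

theorem of_mul (a b : B) : of h (a * b) = of h a * of h b :=
  haveI := h.continuousMul
  ((UniformSpace.Completion.isDenseInducing_coe.prodMap
    UniformSpace.Completion.isDenseInducing_coe).extend_eq
      ((UniformSpace.Completion.continuous_coe B).comp
        (continuous_mul : Continuous fun p : B × B => p.1 * p.2)) (a, b)).symm

instance : IsUniformAddGroup h.Completion :=
  haveI := h.isUniformAddGroup
  inferInstanceAs (IsUniformAddGroup (UniformSpace.Completion B))

instance : ContinuousConstSMul F h.Completion :=
  haveI := h.uniformContinuousConstSMul
  inferInstanceAs (ContinuousConstSMul F (UniformSpace.Completion B))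

instance : ContinuousMul h.Completion where
  continuous_mul := by
    have := h.isUniformAddGroup
    have := h.continuousMul
    let m := (AddMonoidHom.mul : B →+ B →+ B).compr₂ UniformSpace.Completion.toCompl
    have hm : Continuous fun p : B × B => m p.1 p.2 :=
      (UniformSpace.Completion.continuous_coe B).comp continuous_mul
    have di : IsDenseInducing (UniformSpace.Completion.toCompl : B → UniformSpace.Completion B) :=
      UniformSpace.Completion.isDenseInducing_coe
    exact (di.extend_Z_bilin di hm :)

theorem ind {p : h.Completion → Prop} (hp : IsClosed {x | p x}) (hB : ∀ b, p (of h b)) :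
    ∀ x, p x := fun x => isClosed_property (denseRange_of h) hp hB x

noncomputable instance : NonUnitalRing h.Completion where
  left_distrib a b c := by
    revert a; refine ind h (isClosed_eq (by fun_prop) (by fun_prop)) fun a => ?_
    revert b; refine ind h (isClosed_eq (by fun_prop) (by fun_prop)) fun b => ?_
    revert c; refine ind h (isClosed_eq (by fun_prop) (by fun_prop)) fun c => ?_
    simp only [← of_add, ← of_mul, mul_add]
  right_distrib a b c := by
    revert a; refine ind h (isClosed_eq (by fun_prop) (by fun_prop)) fun a => ?_
    revert b; refine ind h (isClosed_eq (by fun_prop) (by fun_prop)) fun b => ?_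
    revert c; refine ind h (isClosed_eq (by fun_prop) (by fun_prop)) fun c => ?_
    simp only [← of_add, ← of_mul, add_mul]
  zero_mul a := by
    revert a; refine ind h (isClosed_eq (by fun_prop) (by fun_prop)) fun a => ?_
    rw [← of_zero, ← of_mul, zero_mul]
  mul_zero a := by
    revert a; refine ind h (isClosed_eq (by fun_prop) (by fun_prop)) fun a => ?_
    rw [← of_zero, ← of_mul, mul_zero]
  mul_assoc a b c := by
    revert a
    refine ind h (isClosed_eq ((continuous_id.mul continuous_const).mul continuous_const)
      (continuous_id.mul continuous_const)) fun a => ?_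
    revert b
    refine ind h (isClosed_eq ((continuous_const.mul continuous_id).mul continuous_const)
      (continuous_const.mul (continuous_id.mul continuous_const))) fun b => ?_
    revert c
    refine ind h (isClosed_eq (continuous_const.mul continuous_id)
      (continuous_const.mul (continuous_const.mul continuous_id))) fun c => ?_
    simp only [← of_mul, mul_assoc]

instance : IsScalarTower F h.Completion h.Completion where
  smul_assoc r a b := by
    change (r • a) * b = r • (a * b)
    revert a
    refine ind h (isClosed_eq ((continuous_id.const_smul r).mul continuous_const)
      ((continuous_id.mul continuous_const).const_smul r)) fun a => ?_
    revert b
    refine ind h (isClosed_eq (continuous_const.mul continuous_id)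
      ((continuous_const.mul continuous_id).const_smul r)) fun b => ?_
    simp only [← of_mul, ← of_smul, smul_mul_assoc]

instance : SMulCommClass F h.Completion h.Completion where
  smul_comm r a b := by
    change r • (a * b) = a * (r • b)
    revert a
    refine ind h (isClosed_eq ((continuous_id.mul continuous_const).const_smul r)
      (continuous_id.mul continuous_const)) fun a => ?_
    revert b
    refine ind h (isClosed_eq ((continuous_const.mul continuous_id).const_smul r)
      (continuous_const.mul (continuous_id.const_smul r))) fun b => ?_
    simp only [← of_mul, ← of_smul, mul_smul_comm]

/-- The completion of a metric algebra is again a metric algebra. -/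
theorem isMetricAlgebra : IsMetricAlgebra ν h.Completion := by
  obtain ⟨γ, hγ, h1, h2, h3, h4⟩ := h.exists_bound
  refine ⟨γ, hγ, fun a b c => ?_, fun r a b => ?_, fun a b c => ?_, fun a b c => ?_⟩
  · revert a; refine ind h (isClosed_le (by fun_prop) (by fun_prop)) fun a => ?_
    revert b; refine ind h (isClosed_le (by fun_prop) (by fun_prop)) fun b => ?_
    revert c; refine ind h (isClosed_le (by fun_prop) (by fun_prop)) fun c => ?_
    simpa only [← of_add, dist_of] using h1 a b c
  · revert a
    refine ind h (isClosed_le ((continuous_id.const_smul r).dist continuous_const)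
      (continuous_const.mul (continuous_id.dist continuous_const))) fun a => ?_
    revert b
    refine ind h (isClosed_le (continuous_const.dist (continuous_id.const_smul r))
      (continuous_const.mul (continuous_const.dist continuous_id))) fun b => ?_
    simpa only [← of_smul, dist_of] using h2 r a b
  · revert a
    refine ind h (isClosed_le ((continuous_id.mul continuous_const).dist continuous_const)
      (continuous_const.mul (continuous_id.dist continuous_const))) fun a => ?_
    revert b
    refine ind h (isClosed_le (continuous_const.dist (continuous_id.mul continuous_const))
      (continuous_const.mul (continuous_const.dist continuous_id))) fun b => ?_
    revert c
    refine ind h (isClosed_le ((continuous_const.mul continuous_id).dist (continuous_const.mul continuous_id))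
      ((continuous_const.mul (continuous_id.dist continuous_const)).mul continuous_const))
      fun c => ?_
    simpa only [← of_mul, ← of_zero h, dist_of] using h3 a b c
  · revert a
    refine ind h (isClosed_le ((continuous_const.mul continuous_id).dist continuous_const)
      (continuous_const.mul (continuous_id.dist continuous_const))) fun a => ?_
    revert b
    refine ind h (isClosed_le (continuous_const.dist (continuous_const.mul continuous_id))
      (continuous_const.mul (continuous_const.dist continuous_id))) fun b => ?_
    revert c
    refine ind h (isClosed_le ((continuous_id.mul continuous_const).dist (continuous_id.mul continuous_const))
      ((continuous_const.mul (continuous_id.dist continuous_const)).mul continuous_const))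
      fun c => ?_
    simpa only [← of_mul, ← of_zero h, dist_of] using h4 a b c

end Completion

end IsMetricAlgebra

/-- A family of subspaces `𝒜 s` of an `F`-algebra, indexed by a monoid `S`, is a finite
`S`-grading if the algebra is their (internal) direct sum, `𝒜 s * 𝒜 t ⊆ 𝒜 (s * t)`, and only
finitely many of them are nonzero. -/
structure IsFiniteGrading {S F A : Type*} [DecidableEq S] [Monoid S] [Field F] [NonUnitalRing A]
    [Module F A] (𝒜 : S → Submodule F A) : Prop where
  isInternal : DirectSum.IsInternal 𝒜
  mul_mem : ∀ {s t : S} {a b : A}, a ∈ 𝒜 s → b ∈ 𝒜 t → a * b ∈ 𝒜 (s * t)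
  finite_support : {s : S | 𝒜 s ≠ ⊥}.Finite

/-- The component of the neutral element of `S`, which is a subalgebra. -/
def IsFiniteGrading.neutralComponent {S F A : Type*} [DecidableEq S] [Monoid S] [Field F]
    [NonUnitalRing A] [Module F A] {𝒜 : S → Submodule F A} (h𝒜 : IsFiniteGrading 𝒜) :
    NonUnitalSubalgebra F A :=
  { 𝒜 1 with
    mul_mem' := fun {a b} ha hb => by
      have hab : a * b ∈ 𝒜 (1 * 1) := h𝒜.mul_mem ha hb
      rw [one_mul] at hab
      exact hab }

/-! ### Products of sequences -/

/-! The proof has three independent parts. Baire category: in a complete nil algebra the closed sets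
`{b | b ^ (n + 1) = 0}` cover the space, so one of them has an interior point `x`. For any `y`, the
points `x + k⁻¹ y` tend to `x`, so `(x + c y) ^ (n + 1)` vanishes for infinitely many scalars `c`. A
polynomial in `c` with infinitely many zeros has zero coefficients, and the top one is `y ^ (n +
1)`. Thus the nil index is bounded, a property that the dense subalgebra inherits. Nagata–Higman: in
characteristic zero, bounded nil index implies nilpotency. Pigeonhole: in a long nonzero product of
homogeneous elements many prefixes share one degree. By left cancellation the blocks between them
lie in the neutral component, so enough of them multiply to zero. -/

theorem seqProd_add {A : Type*} [Semigroup A] (a : ℕ → A) (i j : ℕ) :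
    seqProd a (i + j + 1) = seqProd a i * seqProd (fun n => a (i + 1 + n)) j := by
  induction j with
  | zero => rfl
  | succ j ih =>
    change seqProd a (i + j + 1) * a (i + j + 1 + 1) = _ * (_ * a (i + 1 + (j + 1)))
    rw [ih, mul_assoc, show i + j + 1 + 1 = i + 1 + (j + 1) by omega]

theorem seqProd_congr {A : Type*} [Mul A] {a b : ℕ → A} {n : ℕ} (h : ∀ i ≤ n, a i = b i) :
    seqProd a n = seqProd b n := by
  induction n with
  | zero => exact h 0 le_rfl
  | succ n ih =>
    change seqProd a n * a (n + 1) = seqProd b n * b (n + 1)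
    rw [ih fun i hi => h i (by omega), h _ le_rfl]

theorem map_seqProd {A B : Type*} [Mul A] [Mul B] {f : A → B} (hf : ∀ x y, f (x * y) = f x * f y)
    (a : ℕ → A) (n : ℕ) : f (seqProd a n) = seqProd (fun i => f (a i)) n := by
  induction n with
  | zero => rfl
  | succ n ih =>
    change f (seqProd a n * a (n + 1)) = _ * f (a (n + 1))
    rw [hf, ih]

theorem seqProd_const {A : Type*} [Monoid A] (a : A) (n : ℕ) :
    seqProd (fun _ => a) n = a ^ (n + 1) := by
  induction n with
  | zero => simp [seqProd]
  | succ n ih =>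
    change seqProd (fun _ => a) n * a = _
    rw [ih, ← pow_succ]

theorem continuous_seqProd_const {A : Type*} [TopologicalSpace A] [Mul A] [ContinuousMul A]
    (n : ℕ) : Continuous fun a : A => seqProd (fun _ => a) n := by
  induction n with
  | zero => exact continuous_id
  | succ n ih => exact ih.mul continuous_id

theorem seqProd_mem_graded {S F A : Type*} [DecidableEq S] [Monoid S] [Field F] [NonUnitalRing A]
    [Module F A] {𝒜 : S → Submodule F A} (h𝒜 : IsFiniteGrading 𝒜) {s : ℕ → S} {a : ℕ → A}
    (ha : ∀ i, a i ∈ 𝒜 (s i)) (n : ℕ) : seqProd a n ∈ 𝒜 (seqProd s n) := by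
  induction n with
  | zero => exact ha 0
  | succ n ih => exact h𝒜.mul_mem ih (ha _)

/-! ### Linearization -/

/-- `powCoeff x y n k` is the coefficient of `t ^ k` in `(x + t * y) ^ n`, where `t` is central. -/
def powCoeff {R : Type*} [Semiring R] (x y : R) : ℕ → ℕ → R
  | 0, 0 => 1
  | 0, _ + 1 => 0
  | n + 1, 0 => powCoeff x y n 0 * x
  | n + 1, k + 1 => powCoeff x y n (k + 1) * x + powCoeff x y n k * y

section powCoeff

variable {R : Type*} [Semiring R] (x y : R)

theorem powCoeff_zero (n : ℕ) : powCoeff x y n 0 = x ^ n := by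
  induction n with
  | zero => simp [powCoeff]
  | succ n ih => rw [powCoeff, ih, pow_succ]

theorem powCoeff_eq_zero {n k : ℕ} (h : n < k) : powCoeff x y n k = 0 := by
  induction n generalizing k with
  | zero => cases k with
    | zero => omega
    | succ k => rfl
  | succ n ih => cases k with
    | zero => omega
    | succ k => rw [powCoeff, ih (by omega), ih (by omega), zero_mul, zero_mul, add_zero]

theorem powCoeff_self (n : ℕ) : powCoeff x y n n = y ^ n := by
  induction n with
  | zero => simp [powCoeff]
  | succ n ih => rw [powCoeff, ih, powCoeff_eq_zero _ _ (Nat.lt_succ_self n), zero_mul, zero_add,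
      pow_succ]

theorem powCoeff_one (n : ℕ) :
    powCoeff x y (n + 1) 1 = ∑ i ∈ Finset.range (n + 1), x ^ i * y * x ^ (n - i) := by
  induction n with
  | zero => simp [powCoeff]
  | succ n ih =>
    rw [powCoeff, ih, powCoeff_zero, Finset.sum_range_succ _ (n + 1), Finset.sum_mul]
    congr 1
    · refine Finset.sum_congr rfl fun i hi => ?_
      have : n + 1 - i = n - i + 1 := by have := Finset.mem_range.1 hi; omega
      rw [this, pow_succ, ← mul_assoc]
    · simp

theorem add_smul_pow {F R : Type*} [CommSemiring F] [Semiring R] [Algebra F R] (x y : R) (c : F)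
    (n : ℕ) : (x + c • y) ^ n = ∑ k ∈ Finset.range (n + 1), c ^ k • powCoeff x y n k := by
  induction n with
  | zero => simp [powCoeff]
  | succ n ih =>
    -- The sum on the right can run up to index `n` because its last coefficient, `powCoeff x y n (n
    -- + 1)`, is zero.
    have h1 : ∑ k ∈ Finset.range (n + 1), c ^ k • powCoeff x y n k * x =
        powCoeff x y n 0 * x +
          ∑ k ∈ Finset.range (n + 1), c ^ (k + 1) • (powCoeff x y n (k + 1) * x) := by
      rw [Finset.sum_range_succ' _ n, Finset.sum_range_succ _ n,
        powCoeff_eq_zero x y (Nat.lt_succ_self n)]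
      simp [add_comm]
    rw [pow_succ, ih, mul_add, Finset.sum_mul, Finset.sum_mul, h1,
      Finset.sum_range_succ' _ (n + 1), pow_zero, one_smul]
    simp only [powCoeff, smul_add, Finset.sum_add_distrib, mul_smul_comm, smul_mul_assoc, smul_smul,
      ← pow_succ']
    abel

end powCoeff

/-- Linear functionals separate the points of `M ⧸ I`, and each one turns the sum into a scalar
polynomial in `c` with infinitely many roots. -/
theorem coeff_mem_of_infinite {F M : Type*} [Field F] [AddCommGroup M] [Module F M]
    (I : Submodule F M) (v : ℕ → M) (n : ℕ)
    (h : {c : F | ∑ k ∈ Finset.range n, c ^ k • v k ∈ I}.Infinite) {k : ℕ} (hk : k < n) :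
    v k ∈ I := by
  rw [← Submodule.Quotient.mk_eq_zero, ← Module.forall_dual_apply_eq_zero_iff F]
  intro f
  let g : M →ₗ[F] F := f ∘ₗ I.mkQ
  let p : Polynomial F := ∑ k ∈ Finset.range n, Polynomial.monomial k (g (v k))
  have hp : p = 0 := by
    refine Polynomial.eq_zero_of_infinite_isRoot p (h.mono fun c hc => ?_)
    have hg : g (∑ k ∈ Finset.range n, c ^ k • v k) = 0 := by
      simp only [g, LinearMap.comp_apply]
      rw [Submodule.mkQ_apply, (Submodule.Quotient.mk_eq_zero I).2 hc, map_zero]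
    rw [map_sum] at hg
    simp only [Set.mem_ofPred_eq, Polynomial.IsRoot, p, Polynomial.eval_finsetSum,
      Polynomial.eval_monomial]
    rw [← hg]
    exact Finset.sum_congr rfl fun k _ => by rw [map_smul, smul_eq_mul, mul_comm]
  have := congrArg (Polynomial.coeff · k) hp
  have hg : g (v k) = 0 := by
    simpa [p, Polynomial.finsetSum_coeff, Polynomial.coeff_monomial, hk] using this
  exact hg

theorem powCoeff_mem_of_infinite {F R : Type*} [Field F] [Ring R] [Algebra F R]
    (I : Ideal R) (x y : R) (n : ℕ) (h : {c : F | (x + c • y) ^ n ∈ I}.Infinite) {k : ℕ}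
    (hk : k ≤ n) : powCoeff x y n k ∈ I := by
  refine coeff_mem_of_infinite (I.restrictScalars F) (powCoeff x y n) (n + 1) (h.mono ?_)
    (Nat.lt_succ_of_le hk)
  intro c hc
  simpa only [Set.mem_ofPred_eq, Submodule.restrictScalars_mem, ← add_smul_pow] using hc

/-! ### The Nagata–Higman theorem -/

/-- Higman's double sum of `x ^ i z y ^ j x ^ (n - i) y ^ (n - j)`, taken in two ways. For fixed `j`
it is the linearized power identity at `x`, so the total is in `I`. For fixed `i < n` it is the
identity at `y`. What remains, `i = n`, is `(n + 1) x ^ n z y ^ n`, and `n + 1` is invertible. -/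
theorem pow_mul_mul_pow_mem {F R : Type*} [Field F] [CharZero F] [Ring R] [Algebra F R]
    {N I : Ideal R} [N.IsTwoSided] [I.IsTwoSided] {n : ℕ} (h : ∀ x ∈ N, x ^ (n + 1) ∈ I)
    {x y z : R} (hx : x ∈ N) (hy : y ∈ N) (hz : z ∈ N) : x ^ n * z * y ^ n ∈ I := by
  have lin : ∀ x ∈ N, ∀ y ∈ N, ∑ i ∈ Finset.range (n + 1), x ^ i * y * x ^ (n - i) ∈ I := by
    intro x hx y hy
    rw [← powCoeff_one]
    refine powCoeff_mem_of_infinite (F := F) I x y (n + 1) ?_ (by omega)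
    have : {c : F | (x + c • y) ^ (n + 1) ∈ I} = Set.univ :=
      Set.eq_univ_of_forall fun c =>
        h _ (N.add_mem hx ((N.restrictScalars F).smul_mem c hy))
    rw [this]
    exact Set.infinite_univ
  have hsum : ∑ i ∈ Finset.range (n + 1), ∑ j ∈ Finset.range (n + 1),
      x ^ i * z * (y ^ j * x ^ (n - i) * y ^ (n - j)) ∈ I := by
    rw [Finset.sum_comm]
    refine I.sum_mem fun j _ => ?_
    have := I.mul_mem_right (y ^ (n - j)) (lin x hx (z * y ^ j) (N.mul_mem_right _ hz))
    rw [Finset.sum_mul] at this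
    simpa only [mul_assoc] using this
  rw [Finset.sum_range_succ] at hsum
  have hlow : ∑ i ∈ Finset.range n, ∑ j ∈ Finset.range (n + 1),
      x ^ i * z * (y ^ j * x ^ (n - i) * y ^ (n - j)) ∈ I := by
    refine I.sum_mem fun i hi => ?_
    rw [← Finset.mul_sum]
    have hi := Finset.mem_range.1 hi
    -- Here `i < n` is essential: only a positive power of `x` is known to lie in `N`.
    exact I.mul_mem_left _ (lin y hy _ (N.pow_mem_of_mem hx _ (by omega)))
  have htop := (I.add_mem_iff_right hlow).1 hsum
  have hconst : ∀ j ∈ Finset.range (n + 1),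
      x ^ n * z * (y ^ j * x ^ (n - n) * y ^ (n - j)) = x ^ n * z * y ^ n := by
    intro j hj
    have hj := Finset.mem_range.1 hj
    rw [Nat.sub_self, pow_zero, mul_one, ← pow_add, show j + (n - j) = n by omega]
  rw [Finset.sum_congr rfl hconst, Finset.sum_const, Finset.card_range,
    ← Nat.cast_smul_eq_nsmul F] at htop
  exact ((I.restrictScalars F).smul_mem_iff (Nat.cast_ne_zero.2 n.succ_ne_zero)).1 htop

/-- Induction on `n` with `I` varying: the hypothesis for `n` is applied to two auxiliary ideals.
`J` contains all `x ^ n` by Higman's computation, so it contains all products `P` of `k + 1`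
elements of `N`, that is, `P z y ^ n ∈ I`. Hence `K`, the `v` with `P z v ∈ I` for all such `P` and
`z`, contains all `y ^ n`. -/
theorem exists_seqProd_mem_of_pow_mem {F R : Type*} [Field F] [CharZero F] [Ring R] [Algebra F R]
    (N : Ideal R) [N.IsTwoSided] (n : ℕ) (I : Ideal R) [I.IsTwoSided] (h : ∀ x ∈ N, x ^ n ∈ I) :
    ∃ k, ∀ a : ℕ → R, (∀ i, a i ∈ N) → seqProd a k ∈ I := by
  induction n generalizing I with
  | zero =>
    have : I = ⊤ := (Ideal.eq_top_iff_one I).2 (by simpa using h 0 N.zero_mem)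
    exact ⟨0, fun a _ => this ▸ Submodule.mem_top⟩
  | succ n ih =>
    let J : Ideal R :=
      { carrier := {u | ∀ z ∈ N, ∀ y ∈ N, u * z * y ^ n ∈ I}
        add_mem' := fun {u v} hu hv z hz y hy => by
          rw [add_mul, add_mul]; exact I.add_mem (hu z hz y hy) (hv z hz y hy)
        zero_mem' := fun z _ y _ => by simp
        smul_mem' := fun r u hu z hz y hy => by
          rw [smul_eq_mul, mul_assoc, mul_assoc, ← mul_assoc u]
          exact I.mul_mem_left r (hu z hz y hy) }
    have : J.IsTwoSided := ⟨fun {u} r hu z hz y hy => by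
      rw [mul_assoc u]; exact hu _ (N.mul_mem_left r hz) y hy⟩
    obtain ⟨k, hk⟩ := ih J fun x hx z hz y hy => pow_mul_mul_pow_mem (F := F) h hx hy hz
    let K : Ideal R :=
      { carrier := {v | ∀ a : ℕ → R, (∀ i, a i ∈ N) → ∀ z ∈ N, seqProd a k * (z * v) ∈ I}
        add_mem' := fun {u v} hu hv a ha z hz => by
          rw [mul_add, mul_add]; exact I.add_mem (hu a ha z hz) (hv a ha z hz)
        zero_mem' := fun a _ z _ => by simp
        smul_mem' := fun r u hu a ha z hz => by
          rw [smul_eq_mul, ← mul_assoc z]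
          exact hu a ha _ (N.mul_mem_right r hz) }
    have : K.IsTwoSided := ⟨fun {u} r hu a ha z hz => by
      rw [← mul_assoc z, ← mul_assoc]; exact I.mul_mem_right r (hu a ha z hz)⟩
    obtain ⟨l, hl⟩ := ih K fun x hx a ha z hz => by
      rw [← mul_assoc]; exact hk a ha z hz x hx
    -- There are `k + 1` factors for `P`, one for `z` and `l + 1` for the element of `K`.
    refine ⟨k + (l + 1) + 1, fun a ha => ?_⟩
    rw [seqProd_add]
    have hsplit := seqProd_add (fun i => a (k + 1 + i)) 0 l
    rw [show 0 + l + 1 = l + 1 by omega] at hsplit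
    rw [hsplit]
    exact hl _ (fun i => ha _) a ha _ (ha _)

/-- The **Nagata–Higman theorem**: a nil algebra of bounded index over a field of characteristic
zero is nilpotent. -/
theorem isNilpotentRing_of_seqProd_const_eq_zero (F : Type*) {B : Type*} [Field F] [CharZero F]
    [NonUnitalRing B] [Module F B] [IsScalarTower F B B] [SMulCommClass F B B] {n : ℕ}
    (h : ∀ b : B, seqProd (fun _ => b) n = 0) : IsNilpotentRing B := by
  -- The augmentation ideal is the copy of `B` in its unitization.
  let N : Ideal (Unitization F B) := RingHom.ker (Unitization.fstHom F B)
  have hN : ∀ x ∈ N, ∃ b : B, x = (b : Unitization F B) := fun x hx =>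
    ⟨x.snd, Unitization.ext (by simpa [N, RingHom.mem_ker] using hx) (by simp)⟩
  obtain ⟨k, hk⟩ := exists_seqProd_mem_of_pow_mem (F := F) N (n + 1) ⊥ fun x hx => by
    obtain ⟨b, rfl⟩ := hN x hx
    rw [← seqProd_const, ← map_seqProd (Unitization.inr_mul F), h, Unitization.inr_zero]
    exact Submodule.zero_mem _
  refine ⟨k, fun a => Unitization.inr_injective (R := F) ?_⟩
  rw [map_seqProd (Unitization.inr_mul F), Unitization.inr_zero]
  exact hk _ fun i => by simp [N, RingHom.mem_ker]

/-! ### Complete nil metric algebras -/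

theorem tendsto_ringNorm_inv_natCast {F : Type*} [Field F] [CharZero F] (ν : RingNorm F)
    (hν : ∀ (n : ℕ) (r : F), ν (n • r) = n * ν r) :
    Filter.Tendsto (fun n : ℕ => ν ((n : F)⁻¹)) Filter.atTop (nhds 0) := by
  refine (tendsto_const_div_atTop_nhds_zero_nat (ν 1)).congr' ?_
  filter_upwards [Filter.eventually_gt_atTop 0] with n hn
  have hF : (n : F) ≠ 0 := Nat.cast_ne_zero.2 hn.ne'
  have hR : (n : ℝ) ≠ 0 := Nat.cast_ne_zero.2 hn.ne'
  have := hν n (n : F)⁻¹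
  rw [nsmul_eq_mul, mul_inv_cancel₀ hF] at this
  rw [this, mul_div_cancel_left₀ _ hR]

theorem IsMetricAlgebra.exists_seqProd_const_eq_zero {F B : Type*} [Field F] [CharZero F]
    {ν : RingNorm F} (hν : ∀ (n : ℕ) (r : F), ν (n • r) = n * ν r) [NonUnitalRing B] [Module F B]
    [IsScalarTower F B B] [SMulCommClass F B B] [MetricSpace B] [CompleteSpace B]
    (hB : IsMetricAlgebra ν B) (hnil : IsNilRing B) :
    ∃ n, ∀ b : B, seqProd (fun _ => b) n = 0 := by
  have := hB.continuousMul
  have := hB.isUniformAddGroup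
  obtain ⟨n, x, hx⟩ := nonempty_interior_of_iUnion_of_closed
    (f := fun n : ℕ => {b : B | seqProd (fun _ => b) n = 0})
    (fun n => isClosed_eq (continuous_seqProd_const n) continuous_const)
    (Set.eq_univ_of_forall fun b => Set.mem_iUnion.2 (hnil b))
  refine ⟨n, fun y => ?_⟩
  have hlim : Filter.Tendsto (fun k : ℕ => x + (k : F)⁻¹ • y) Filter.atTop (nhds x) := by
    have hsmul : Filter.Tendsto (fun k : ℕ => (k : F)⁻¹ • y) Filter.atTop (nhds 0) := by
      obtain ⟨γ, -, -, h2, -, -⟩ := hB.exists_bound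
      refine tendsto_iff_dist_tendsto_zero.2 (squeeze_zero (fun _ => dist_nonneg)
        (fun k => by simpa using h2 (k : F)⁻¹ y 0) ?_)
      simpa using ((tendsto_ringNorm_inv_natCast ν hν).const_mul γ).mul_const (dist y 0)
    simpa using hsmul.const_add x
  obtain ⟨m, hm⟩ := Filter.eventually_atTop.1 (hlim (mem_interior_iff_mem_nhds.1 hx))
  have hinf : {c : F | ((x : Unitization F B) + c • (y : Unitization F B)) ^ (n + 1) ∈
      (⊥ : Ideal (Unitization F B))}.Infinite := by
    refine ((Set.Ici_infinite m).image (f := fun k : ℕ => (k : F)⁻¹)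
      fun i _ j _ hij => Nat.cast_injective (inv_injective hij)).mono ?_
    rintro _ ⟨k, hk, rfl⟩
    have hz : seqProd (fun _ => x + (k : F)⁻¹ • y) n = 0 := hm k hk
    rw [Set.mem_ofPred_eq, ← Unitization.inr_smul, ← Unitization.inr_add, ← seqProd_const,
      ← map_seqProd (Unitization.inr_mul F), hz, Unitization.inr_zero]
    exact Submodule.zero_mem _
  -- Only the top coefficient, `y ^ (n + 1)`, is needed.
  have := powCoeff_mem_of_infinite _ _ _ _ hinf le_rfl
  rw [powCoeff_self, ← seqProd_const, ← map_seqProd (Unitization.inr_mul F),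
    Submodule.mem_bot] at this
  exact Unitization.inr_injective (R := F) (this.trans (Unitization.inr_zero F).symm)

/-! ### Finite gradings by left cancellative monoids -/

section Grading

variable {S F A : Type*} [DecidableEq S] [Monoid S] [Field F] [NonUnitalRing A] [Module F A]
  {𝒜 : S → Submodule F A}

/-- If `g = g * u` in `S`, then `u = 1` by left cancellation, so the block between the two prefixes
is neutral. -/
theorem IsFiniteGrading.exists_seqProd_eq_mul [IsLeftCancelMul S] (h𝒜 : IsFiniteGrading 𝒜)
    {s : ℕ → S} {a : ℕ → A} (ha : ∀ i, a i ∈ 𝒜 (s i)) {i j : ℕ} (hij : i < j)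
    (hs : seqProd s i = seqProd s j) :
    ∃ c : h𝒜.neutralComponent, seqProd a j = seqProd a i * c := by
  obtain ⟨l, rfl⟩ : ∃ l, j = i + l + 1 := ⟨j - i - 1, by omega⟩
  rw [seqProd_add s, left_eq_mul] at hs
  refine ⟨⟨seqProd (fun n => a (i + 1 + n)) l, ?_⟩, seqProd_add a i l⟩
  have := seqProd_mem_graded h𝒜 (s := fun n => s (i + 1 + n)) (fun n => ha (i + 1 + n)) l
  rwa [hs] at this

/-- The `k + 2` cut points bound `k + 1` consecutive neutral blocks; the induction removes the last
cut point. -/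
theorem IsFiniteGrading.exists_seqProd_eq_mul_seqProd [IsLeftCancelMul S]
    (h𝒜 : IsFiniteGrading 𝒜) {s : ℕ → S} {a : ℕ → A} (ha : ∀ i, a i ∈ 𝒜 (s i)) (t : S) (k : ℕ)
    (T : Finset ℕ) (hT : T.card = k + 2) (ht : ∀ i ∈ T, seqProd s i = t) :
    ∃ i, ∃ j ∈ T, ∃ c : ℕ → h𝒜.neutralComponent,
      seqProd a j = seqProd a i * (seqProd c k : h𝒜.neutralComponent) := by
  induction k generalizing T with
  | zero =>
    obtain ⟨i, hi, j, hj, hij⟩ := Finset.one_lt_card.1 (show 1 < T.card by omega)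
    wlog hlt : i < j generalizing i j
    · exact this j hj i hi hij.symm (by omega)
    obtain ⟨c, hc⟩ := h𝒜.exists_seqProd_eq_mul ha hlt ((ht i hi).trans (ht j hj).symm)
    exact ⟨i, j, hj, fun _ => c, hc⟩
  | succ k ih =>
    have hne : T.Nonempty := Finset.card_pos.1 (by omega)
    have hmax := T.max'_mem hne
    obtain ⟨i, j, hj, c, hc⟩ := ih (T.erase (T.max' hne))
      (by rw [Finset.card_erase_of_mem hmax]; omega) fun i hi => ht i (Finset.mem_of_mem_erase hi)
    obtain ⟨d, hd⟩ := h𝒜.exists_seqProd_eq_mul ha (T.lt_max'_of_mem_erase_max' hne hj)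
      ((ht j (Finset.mem_of_mem_erase hj)).trans (ht _ hmax).symm)
    refine ⟨i, T.max' hne, hmax, Function.update c (k + 1) d, ?_⟩
    have hu : seqProd (Function.update c (k + 1) d) (k + 1) = seqProd c k * d := by
      change seqProd (Function.update c (k + 1) d) k * Function.update c (k + 1) d (k + 1) = _
      rw [Function.update_self,
        seqProd_congr (b := c) fun l hl => Function.update_of_ne (by omega) _ _]
    rw [hd, hc, hu, mul_assoc]
    rfl

theorem IsFiniteGrading.exists_seqProd_eq_zero [IsLeftCancelMul S] (h𝒜 : IsFiniteGrading 𝒜)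
    (hnil : IsNilpotentRing h𝒜.neutralComponent) :
    ∃ n, ∀ (s : ℕ → S) (a : ℕ → A), (∀ i, a i ∈ 𝒜 (s i)) → seqProd a n = 0 := by
  obtain ⟨k, hk⟩ := hnil
  let D : Finset S := h𝒜.finite_support.toFinset
  -- This gives `D.card * (k + 1) + 1` prefixes with degrees in `D`, so some degree occurs at least
  -- `k + 2` times.
  refine ⟨D.card * (k + 1), fun s a ha => ?_⟩
  by_contra hne
  have hprefix : ∀ i ≤ D.card * (k + 1), seqProd a i ≠ 0 := by
    intro i hi h0
    rcases hi.eq_or_lt with rfl | hlt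
    · exact hne h0
    · obtain ⟨l, hl⟩ : ∃ l, D.card * (k + 1) = i + l + 1 := ⟨D.card * (k + 1) - i - 1, by omega⟩
      rw [hl, seqProd_add, h0, zero_mul] at hne
      exact hne rfl
  have hmaps : ∀ i ∈ Finset.range (D.card * (k + 1) + 1), seqProd s i ∈ D := by
    intro i hi
    rw [Set.Finite.mem_toFinset, Set.mem_ofPred_eq, Submodule.ne_bot_iff]
    exact ⟨_, seqProd_mem_graded h𝒜 ha i,
      hprefix i (Nat.lt_succ_iff.1 (Finset.mem_range.1 hi))⟩
  obtain ⟨t, -, ht⟩ := Finset.exists_lt_card_fiber_of_mul_lt_card_of_maps_to hmaps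
    (n := k + 1) (by rw [Finset.card_range]; omega)
  obtain ⟨T, hTsub, hTcard⟩ := Finset.exists_subset_card_eq (Nat.succ_le_of_lt ht)
  obtain ⟨i, j, hj, c, hc⟩ := h𝒜.exists_seqProd_eq_mul_seqProd ha t k T hTcard
    fun i hi => (Finset.mem_filter.1 (hTsub hi)).2
  have hjN := Finset.mem_range.1 (Finset.mem_filter.1 (hTsub hj)).1
  refine hprefix j (by omega) ?_
  rw [hc, hk, ZeroMemClass.coe_zero, mul_zero]

/-- By multilinearity, it suffices to kill products of homogeneous elements. -/
theorem IsFiniteGrading.seqProd_mem_span [IsScalarTower F A A] [SMulCommClass F A A]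
    (h𝒜 : IsFiniteGrading 𝒜) (a : ℕ → A) (n : ℕ) :
    seqProd a n ∈
      Submodule.span F {x | ∃ (s : ℕ → S) (b : ℕ → A), (∀ i, b i ∈ 𝒜 (s i)) ∧ seqProd b n = x} := by
  have hspan : ∀ x : A, x ∈ Submodule.span F (⋃ s, (𝒜 s : Set A)) := fun x => by
    rw [← Submodule.iSup_eq_span, h𝒜.isInternal.submodule_iSup_eq_top]; trivial
  induction n with
  | zero =>
    refine Submodule.span_mono ?_ (hspan (a 0))
    intro x hx
    obtain ⟨s, hs⟩ := Set.mem_iUnion.1 hx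
    exact ⟨fun _ => s, fun _ => x, fun _ => hs, rfl⟩
  | succ n ih =>
    change seqProd a n * a (n + 1) ∈ _
    have hx := hspan (a (n + 1))
    generalize seqProd a n = x at ih ⊢
    generalize a (n + 1) = y at hx ⊢
    induction ih, hx using Submodule.span_induction₂ with
    | mem_mem x y hx hy =>
      obtain ⟨s, b, hb, rfl⟩ := hx
      obtain ⟨t, ht⟩ := Set.mem_iUnion.1 hy
      refine Submodule.subset_span
        ⟨Function.update s (n + 1) t, Function.update b (n + 1) y, fun i => ?_, ?_⟩
      · rcases eq_or_ne i (n + 1) with rfl | hi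
        · simpa using ht
        · simpa [hi] using hb i
      · change seqProd (Function.update b (n + 1) y) n * Function.update b (n + 1) y (n + 1) = _
        rw [Function.update_self,
          seqProd_congr (b := b) fun l hl => Function.update_of_ne (by omega) _ _]
    | zero_left y hy => rw [zero_mul]; exact Submodule.zero_mem _
    | zero_right x hx => rw [mul_zero]; exact Submodule.zero_mem _
    | add_left x y z _ _ _ hx hy => rw [add_mul]; exact Submodule.add_mem _ hx hy
    | add_right x y z _ _ _ hx hy => rw [mul_add]; exact Submodule.add_mem _ hx hy
    | smul_left r x y _ _ h => rw [smul_mul_assoc]; exact Submodule.smul_mem _ r h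
    | smul_right r x y _ _ h => rw [mul_smul_comm]; exact Submodule.smul_mem _ r h

/-- An algebra with a finite grading by a left cancellative monoid is nilpotent as soon as its
neutral component is. -/
theorem IsFiniteGrading.isNilpotentRing [IsLeftCancelMul S] [IsScalarTower F A A]
    [SMulCommClass F A A] (h𝒜 : IsFiniteGrading 𝒜)
    (hnil : IsNilpotentRing h𝒜.neutralComponent) : IsNilpotentRing A := by
  obtain ⟨n, hn⟩ := h𝒜.exists_seqProd_eq_zero hnil
  refine ⟨n, fun a => ?_⟩
  have hle : Submodule.span F
      {x | ∃ (s : ℕ → S) (b : ℕ → A), (∀ i, b i ∈ 𝒜 (s i)) ∧ seqProd b n = x} ≤ ⊥ := by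
    rw [Submodule.span_le]
    rintro _ ⟨s, b, hb, rfl⟩
    exact hn s b hb
  exact hle (h𝒜.seqProd_mem_span a n)

end Grading

theorem mainTheorem4 {S F A : Type*}
    [DecidableEq S] [Monoid S] [IsLeftCancelMul S]
    [Field F] [CharZero F] (ν : RingNorm F) (hν : ∀ (n : ℕ) (r : F), ν (n • r) = n * ν r)
    [NonUnitalRing A] [Module F A] [IsScalarTower F A A] [SMulCommClass F A A]
    (𝒜 : S → Submodule F A) (h𝒜 : IsFiniteGrading 𝒜)
    [MetricSpace h𝒜.neutralComponent] (hmetric : IsMetricAlgebra ν h𝒜.neutralComponent) :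
    (IsNilRing hmetric.Completion → IsNilpotentRing A) ∧
      (CompleteSpace h𝒜.neutralComponent → IsNilRing h𝒜.neutralComponent →
        IsNilpotentRing A) := by
  refine ⟨fun hnil => h𝒜.isNilpotentRing ?_, fun _ hnil => h𝒜.isNilpotentRing ?_⟩
  · obtain ⟨n, hn⟩ := (IsMetricAlgebra.Completion.isMetricAlgebra
      hmetric).exists_seqProd_const_eq_zero hν hnil
    refine isNilpotentRing_of_seqProd_const_eq_zero F (n := n) fun b => ?_
    -- The embedding is isometric, so the bounded nil index descends from the completion.
    have hinj : Function.Injective (IsMetricAlgebra.Completion.of hmetric) := fun a b hab => by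
      rw [← dist_eq_zero, ← IsMetricAlgebra.Completion.dist_of hmetric, hab, dist_self]
    apply hinj
    rw [map_seqProd (IsMetricAlgebra.Completion.of_mul hmetric), hn,
      IsMetricAlgebra.Completion.of_zero]
  · obtain ⟨n, hn⟩ := hmetric.exists_seqProd_const_eq_zero hν hnil
    exact isNilpotentRing_of_seqProd_const_eq_zero F hn
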